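/- Let $\beta \in (1,2)$ be a Pisot number, that is, a real algebraic integer greater than $1$ all of whose other Galois conjugates have modulus less than $1$. Set $\Delta(\beta) = \{(\beta,\alpha) \in \mathbb{R}^2 : 0 \le \alpha \le 2-\beta\}$. For $(\beta,\alpha) \in \Delta(\beta)$ put $p = (1-\alpha)/\beta$ and $J_{\beta,\alpha} = \left[\frac{-\alpha}{\beta-1}, \frac{1-\alpha}{\beta-1}\right]$, and let $T^{\pm}_{\beta,\alpha} \colon J_{\beta,\alpha} \to J_{\beta,\alpha}$ be the maps $$T^{+}_{\beta,\alpha}(x) = \begin{cases} \beta x+\alpha & \text{if } x<p,\\ \beta x+\alpha-1 & \text{if } x \ge p,\end{cases} \qquad T^{-}_{\beta,\alpha}(x) = \begin{cases} \beta x+\alpha & \text{if } x\le p,\\ \beta x+\alpha-1 & \text{if } x>p.\end{cases}$$ For $x \in J_{\beta,\alpha}$ let $\tau^{\pm}_{\beta,\alpha}(x) = (\omega^\pm_n(x))_{n\ge 1} \in \{0,1\}^{\mathbb{N}}$, where $\omega^+_n(x) = 0$ if $(T^+_{\beta,\alpha})^{n-1}(x) < p$ and $\omega^+_n(x)=1$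 otherwise, and $\omega^-_n(x) = 0$ if $(T^-_{\beta,\alpha})^{n-1}(x) \le p$ and $\omega^-_n(x)=1$ otherwise. Let $\Omega_{\beta,\alpha} = \tau^+_{\beta,\alpha}(J_{\beta,\alpha}) \cup \tau^-_{\beta,\alpha}(J_{\beta,\alpha})$. Then the set of $(\beta,\alpha) \in \Delta(\beta)$ for which $\Omega_{\beta,\alpha}$ is sofic is dense in $\Delta(\beta)$. Here a set $\Omega \subseteq \{0,1\}^{\mathbb{N}}$ is called sofic if it is a factor of a (one-sided) subshift of finite type, that is, if there are a finite alphabet $A$, a set $Y \subseteq A^{\mathbb{N}}$ consisting of all sequences in which none of finitely many given finite words occurs, and a continuous surjection $Y \to \Omega$ commuting with the left shifts. -/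

import Mathlib

namespace IntermediateBeta

open SymbolicDynamics.FullShift

/-! ### Subshifts of finite type and sofic shifts (one-sided, indexed by `ℕ`) -/

/-- `Y ⊆ A^ℕ` is a (one-sided) subshift of finite type: it is the set of all sequences in which
no pattern of some finite list of forbidden finite patterns occurs. -/
def IsSFT {A : Type*} [Inhabited A] (Y : Set (ℕ → A)) : Prop :=
  ∃ F : Set (Pattern A ℕ), F.Finite ∧ Y = forbidden F

/-- `S ⊆ A^ℕ` is a factor of `Y ⊆ B^ℕ`: there is a continuous surjection `Y → S` that
intertwines the left shifts. Only the values of `f` on `Y` matter. -/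
def IsFactorOf {A B : Type*} [TopologicalSpace A] [TopologicalSpace B]
    (S : Set (ℕ → A)) (Y : Set (ℕ → B)) : Prop :=
  ∃ f : (ℕ → B) → (ℕ → A), ContinuousOn f Y ∧ f '' Y = S ∧
    ∀ y ∈ Y, f (shift 1 y) = shift 1 (f y)

/-- `S` is sofic: it is a factor of a subshift of finite type over some finite (discrete,
nonempty) alphabet. (Closedness and shift invariance of `S` are then automatic when `A` is
discrete, as `S` is an equivariant continuous image of a compact shift-invariant set.) -/
def IsSofic {A : Type*} [TopologicalSpace A] (S : Set (ℕ → A)) : Prop :=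
  ∃ (k : ℕ) (Y : Set (ℕ → Fin (k + 1))), IsSFT Y ∧ IsFactorOf S Y

/-! ### Intermediate beta-transformations and beta-shifts -/

/-- The critical point `p = (1 - α) / β`. -/
noncomputable def critPt (β α : ℝ) : ℝ := (1 - α) / β

/-- The upper intermediate beta-transformation `T⁺`. -/
noncomputable def Tplus (β α x : ℝ) : ℝ :=
  if x < critPt β α then β * x + α else β * x + α - 1

/-- The lower intermediate beta-transformation `T⁻`. -/
noncomputable def Tminus (β α x : ℝ) : ℝ :=
  if x ≤ critPt β α then β * x + α else β * x + α - 1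

/-- The domain `J = [-α/(β-1), (1-α)/(β-1)]` of `T⁺` and `T⁻`. -/
def dom (β α : ℝ) : Set ℝ := Set.Icc (-α / (β - 1)) ((1 - α) / (β - 1))

/-- The upper expansion map; the letter of index `n` (counted from `0`) is read off from the
`n`-th iterate of `T⁺`. -/
noncomputable def tauPlus (β α x : ℝ) : ℕ → Fin 2 :=
  fun n => if (Tplus β α)^[n] x < critPt β α then 0 else 1

/-- The lower expansion map. -/
noncomputable def tauMinus (β α x : ℝ) : ℕ → Fin 2 :=
  fun n => if (Tminus β α)^[n] x ≤ critPt β α then 0 else 1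

/-- The intermediate beta-shift `Ω = Ω⁺ ∪ Ω⁻`, where `Ω^±` is the image of `J` under the
expansion map. -/
def betaShift (β α : ℝ) : Set (ℕ → Fin 2) :=
  tauPlus β α '' dom β α ∪ tauMinus β α '' dom β α

/-- The fibre `Δ(β) = {(β, α) : 0 ≤ α ≤ 2 - β}` of the parameter space, as a subset of `ℝ²`. -/
def fibre (β : ℝ) : Set (ℝ × ℝ) := {q | q.1 = β ∧ 0 ≤ q.2 ∧ q.2 ≤ 2 - β}

/-- Pisot numbers: real algebraic integers `β > 1` all of whose other Galois conjugates (the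
complex roots of the minimal polynomial over `ℚ` different from `β`) have modulus `< 1`. -/
def IsPisot (β : ℝ) : Prop :=
  IsIntegral ℤ β ∧ 1 < β ∧
    ∀ z : ℂ, Polynomial.aeval z (minpoly ℚ β) = 0 → z ≠ (β : ℂ) → ‖z‖ < 1

end IntermediateBeta

/-!
For a Pisot number `β` the rational parameters `α` already suffice: they are dense in `[0, 2 - β]`,
and each of them gives a sofic shift, for the following reasons.

Write `p` for the critical point. The beta-shift is the set `lexGap u v` of the binary sequences
each of whose tails is lexicographically at most `u = τ⁻(p)` if it starts with `0`, and at least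
`v = τ⁺(p)` if it starts with `1` (`betaShift_eq_lexGap`). That every expansion satisfies these
conditions is monotonicity of the expansion maps. For the converse, let `x n` be the value of the
`n`-th tail of a sequence `ω` in `lexGap u v` as an expansion in base `β`. Suppose that the letters
of `ω` are separated by `p` up to an error `D`, that is, `x n ≤ p + D` where `ω n = 0` and
`x n ≥ p - D` where `ω n = 1`. Looking at the first place where a tail differs from `u` or `v`, one
sees that they are separated up to the error `D / β` (`separation_step`), and hence without error.
Moreover `x n = p` only if the tail is `u` or `v` itself, and `u` and `v` cannot both occur as
tails of `ω`. So `ω` is an upper or a lower expansion of `x 0`.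

If `u` and `v` have finitely many tails, then `lexGap u v` is sofic (`isSofic_lexGap`): it is
presented by a finite graph whose states record which tails of `u` and `v` currently bound the
remaining sequence. Finally, the orbits of `p` are finite when `β` is Pisot and `α` is rational
(`IsOrbit.finite_range_of_isPisot`): up to a common denominator they consist of algebraic integers
of `ℚ(β)` with bounded conjugates.
-/

namespace IntermediateBeta

open SymbolicDynamics.FullShift

/-! ### Sofic sets from finite transition relations -/

/-- The letterwise image of the set of infinite paths of a relation on a finite type is sofic. -/
theorem isSofic_image_paths {A B : Type*} [TopologicalSpace A] [Finite B] [Nonempty B]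
    (R : B → B → Prop) (g : B → A) :
    IsSofic ((fun (y : ℕ → B) n => g (y n)) '' {y | ∀ n, R (y n) (y (n + 1))}) := by
  obtain ⟨N, ⟨e⟩⟩ := Finite.exists_equiv_fin B
  obtain ⟨k, rfl⟩ : ∃ k, N = k + 1 := by
    obtain ⟨b⟩ := ‹Nonempty B›
    exact Nat.exists_eq_succ_of_ne_zero fun h => by subst h; exact (e b).elim0
  refine ⟨k, {z | ∀ n, R (e.symm (z n)) (e.symm (z (n + 1)))}, ?_, ?_⟩
  · refine ⟨{P | P.support = {0, 1} ∧ ¬ R (e.symm (P.config 0)) (e.symm (P.config 1))}, ?_, ?_⟩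
    · exact (finite_setOfPred_pattern_support_eq (A := Fin (k + 1)) {0, 1}).subset
        fun P hP => hP.1
    · ext z
      constructor
      · rintro hz P ⟨hs, hR⟩ n hocc
        refine hR ?_
        rw [← hocc 0 (by simp [hs]), ← hocc 1 (by simp [hs])]
        exact hz n
      · intro hz n
        by_contra hR
        let P : Pattern (Fin (k + 1)) ℕ :=
          ⟨fun i => if i ∈ ({0, 1} : Finset ℕ) then z (n + i) else default, {0, 1},
            fun i hi => if_neg hi⟩
        refine hz P ⟨rfl, by simpa [P] using hR⟩ n fun i hi => ?_
        exact (if_pos hi).symm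
  · refine ⟨fun z n => g (e.symm (z n)), ?_, ?_, fun _ _ => rfl⟩
    · refine (continuous_pi fun n => ?_).continuousOn
      exact (continuous_of_discreteTopology (f := fun i => g (e.symm i))).comp (continuous_apply n)
    · ext ω
      constructor
      · rintro ⟨z, hz, rfl⟩
        exact ⟨fun n => e.symm (z n), hz, rfl⟩
      · rintro ⟨y, hy, rfl⟩
        exact ⟨fun n => e (y n), by simpa using hy, by simp⟩

/-! ### Sequences constrained by lexicographic bounds -/

/-- The (weak) lexicographic order on binary sequences: at the first index where the two sequences
differ, if there is one, `ω` has the smaller letter. -/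
def LexLE (ω η : ℕ → Fin 2) : Prop :=
  ∀ n, (∀ m < n, ω m = η m) → ω n ≤ η n

theorem LexLE.refl (ω : ℕ → Fin 2) : LexLE ω ω := fun _ _ => le_rfl

theorem LexLE.shift_one {ω η : ℕ → Fin 2} (h : LexLE ω η) (h0 : ω 0 = η 0) :
    LexLE (shift 1 ω) (shift 1 η) := by
  intro n hn
  simp only [shift_apply, add_comm 1] at hn ⊢
  refine h (n + 1) fun m hm => ?_
  cases m with
  | zero => exact h0
  | succ m => exact hn m (by omega)

/-- The binary sequences each of whose tails is lexicographically at most `u` if it starts with `0`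
and at least `v` if it starts with `1`. -/
def lexGap (u v : ℕ → Fin 2) : Set (ℕ → Fin 2) :=
  {ω | ∀ n, (ω n = 0 → LexLE (shift n ω) u) ∧ (ω n = 1 → LexLE v (shift n ω))}

/-- A state of the presenting graph is a letter together with a set of tails of `u` that are upper
bounds, and a set of tails of `v` that are lower bounds, for the remaining sequence. -/
theorem isSofic_lexGap {u v : ℕ → Fin 2} (hu : (Set.range fun k => shift k u).Finite)
    (hv : (Set.range fun k => shift k v).Finite) : IsSofic (lexGap u v) := by
  set U := Set.range fun k => shift k u with hU
  set V := Set.range fun k => shift k v with hV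
  have huU : u ∈ U := ⟨0, shift_zero u⟩
  have hvV : v ∈ V := ⟨0, shift_zero v⟩
  have hU1 : ∀ w ∈ U, shift 1 w ∈ U := by
    rintro _ ⟨k, rfl⟩
    exact ⟨k + 1, shift_add k 1 u⟩
  have hV1 : ∀ w ∈ V, shift 1 w ∈ V := by
    rintro _ ⟨k, rfl⟩
    exact ⟨k + 1, shift_add k 1 v⟩
  have : Finite (𝒫 U) := hu.finite_subsets
  have : Finite (𝒫 V) := hv.finite_subsets
  have : Nonempty (𝒫 U) := ⟨⟨∅, Set.empty_subset _⟩⟩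
  have : Nonempty (𝒫 V) := ⟨⟨∅, Set.empty_subset _⟩⟩
  let R : (𝒫 U) × (𝒫 V) × Fin 2 → (𝒫 U) × (𝒫 V) × Fin 2 → Prop := fun a b =>
    (a.2.2 = 0 → u ∈ a.1.1) ∧ (a.2.2 = 1 → v ∈ a.2.1.1) ∧
    (∀ w ∈ a.1.1, a.2.2 ≤ w 0 ∧ (a.2.2 = w 0 → shift 1 w ∈ b.1.1)) ∧
    (∀ w ∈ a.2.1.1, w 0 ≤ a.2.2 ∧ (w 0 = a.2.2 → shift 1 w ∈ b.2.1.1))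
  convert isSofic_image_paths R (fun a => a.2.2)
  ext ω
  constructor
  · intro hω
    refine ⟨fun n => (⟨{w ∈ U | LexLE (shift n ω) w}, Set.sep_subset _ _⟩,
      ⟨{w ∈ V | LexLE w (shift n ω)}, Set.sep_subset _ _⟩, ω n), fun n => ?_, rfl⟩
    refine ⟨fun h => ⟨huU, (hω n).1 h⟩, fun h => ⟨hvV, (hω n).2 h⟩, ?_, ?_⟩
    · rintro w ⟨hw, hle⟩
      refine ⟨hle 0 (by simp), fun h => ⟨hU1 w hw, ?_⟩⟩
      rw [shift_add]
      exact hle.shift_one h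
    · rintro w ⟨hw, hle⟩
      refine ⟨hle 0 (by simp), fun h => ⟨hV1 w hw, ?_⟩⟩
      rw [shift_add]
      exact hle.shift_one h
  · rintro ⟨y, hy, rfl⟩ n
    have hup : ∀ m n, ∀ w ∈ (y n).1.1, (∀ i < m, (y (n + i)).2.2 = w i) →
        (y (n + m)).2.2 ≤ w m := by
      intro m
      induction m with
      | zero => exact fun n w hw _ => ((hy n).2.2.1 w hw).1
      | succ m ih =>
        intro n w hw hi
        have := ih (n + 1) (shift 1 w) (((hy n).2.2.1 w hw).2 (hi 0 (by omega))) fun i him => by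
          simpa [add_assoc, add_comm 1 i] using hi (i + 1) (by omega)
        simpa [add_assoc, add_comm 1 m] using this
    have hlow : ∀ m n, ∀ w ∈ (y n).2.1.1, (∀ i < m, w i = (y (n + i)).2.2) →
        w m ≤ (y (n + m)).2.2 := by
      intro m
      induction m with
      | zero => exact fun n w hw _ => ((hy n).2.2.2 w hw).1
      | succ m ih =>
        intro n w hw hi
        have := ih (n + 1) (shift 1 w) (((hy n).2.2.2 w hw).2 (hi 0 (by omega))) fun i him => by
          simpa [add_assoc, add_comm 1 i] using hi (i + 1) (by omega)
        simpa [add_assoc, add_comm 1 m] using this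
    exact ⟨fun h m hm => hup m n u ((hy n).1 h) hm, fun h m hm => hlow m n v ((hy n).2.1 h) hm⟩

/-! ### Affine orbits driven by a binary sequence -/

/-- `x` is an orbit driven by the binary sequence `ω`: its step at time `n` is the branch
`t ↦ β t + α - ω n`. -/
def IsOrbit (β α : ℝ) (x : ℕ → ℝ) (ω : ℕ → Fin 2) : Prop :=
  ∀ n, x (n + 1) = β * x n + α - ((ω n : ℕ) : ℝ)

theorem IsOrbit.shift {β α : ℝ} {x : ℕ → ℝ} {ω : ℕ → Fin 2} (h : IsOrbit β α x ω) (k : ℕ) :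
    IsOrbit β α (fun n => x (k + n)) (shift k ω) := fun n => h (k + n)

theorem IsOrbit.sub_eq {β α : ℝ} {x y : ℕ → ℝ} {ω η : ℕ → Fin 2} (hx : IsOrbit β α x ω)
    (hy : IsOrbit β α y η) (m : ℕ) (h : ∀ i < m, ω i = η i) :
    x m - y m = β ^ m * (x 0 - y 0) := by
  induction m with
  | zero => simp
  | succ m ih =>
    rw [hx m, hy m, h m (by omega), pow_succ]
    linear_combination β * ih fun i hi => h i (by omega)

/-- Bounded orbits driven by the same sequence coincide, because the map is expanding. -/
theorem IsOrbit.start_eq_of_bounded {β α C : ℝ} (hβ : 1 < β) {x y : ℕ → ℝ} {ω : ℕ → Fin 2}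
    (hx : IsOrbit β α x ω) (hy : IsOrbit β α y ω) (hxC : ∀ n, |x n| ≤ C)
    (hyC : ∀ n, |y n| ≤ C) : x 0 = y 0 := by
  by_contra hne
  have hpos : 0 < |x 0 - y 0| := abs_pos.2 (sub_ne_zero.2 hne)
  obtain ⟨m, hm⟩ := pow_unbounded_of_one_lt (2 * C / |x 0 - y 0|) hβ
  rw [div_lt_iff₀ hpos] at hm
  have h1 := hx.sub_eq hy m fun _ _ => rfl
  have h2 : |x m - y m| = β ^ m * |x 0 - y 0| := by
    rw [h1, abs_mul, abs_of_pos (by positivity)]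
  have h3 := abs_sub (x m) (y m)
  linarith [hxC m, hyC m]

/-- An orbit that starts to the left of another stays to its left as long as the driving letters
agree; so the driving sequences are lexicographically ordered if the letters are separated by a
common threshold `p`. -/
theorem IsOrbit.lexLE_of_lt {β α p : ℝ} (hβ : 1 < β) {x y : ℕ → ℝ} {ω η : ℕ → Fin 2}
    (hx : IsOrbit β α x ω) (hy : IsOrbit β α y η) (hω : ∀ n, ω n = 1 → p ≤ x n)
    (hη : ∀ n, η n = 0 → y n ≤ p) (h : x 0 < y 0) : LexLE ω η := by
  intro n hn
  have h1 := hx.sub_eq hy n hn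
  have h2 : x n < y n := by
    have : β ^ n * (x 0 - y 0) < 0 := mul_neg_of_pos_of_neg (by positivity) (by linarith)
    linarith
  by_contra hlt
  have h3 := hω n (by omega)
  have h4 := hη n (by omega)
  linarith

/-- A discrepancy at the first difference of the driving sequences contracts at least by the factor
`β` when it is pulled back to time `0`. The sign `s` covers both orders of `x` and `y`. -/
theorem IsOrbit.eq_or_mul_sub_lt {β α D s : ℝ} (hβ : 1 < β) {x y : ℕ → ℝ} {ω η : ℕ → Fin 2}
    (hx : IsOrbit β α x ω) (hy : IsOrbit β α y η) (h0 : ω 0 = η 0) (hD : 0 ≤ D)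
    (h : ∀ m, (∀ i < m, ω i = η i) → ω m ≠ η m → s * (x m - y m) < D) :
    ω = η ∨ s * (x 0 - y 0) < D / β := by
  classical
  by_cases heq : ω = η
  · exact Or.inl heq
  right
  have hex : ∃ m, ω m ≠ η m := Function.ne_iff.1 heq
  have hlt : ∀ i < Nat.find hex, ω i = η i := fun i hi => not_not.1 (Nat.find_min hex hi)
  have h1 := h _ hlt (Nat.find_spec hex)
  rw [hx.sub_eq hy _ hlt] at h1
  have hm : Nat.find hex ≠ 0 := fun hz => Nat.find_spec hex (by rw [hz]; exact h0)
  have hpow : β ≤ β ^ Nat.find hex := le_self_pow₀ hβ.le hm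
  rw [lt_div_iff₀ (by linarith)]
  rcases le_or_gt (s * (x 0 - y 0)) 0 with hs | hs
  · rcases hD.eq_or_lt with rfl | hD'
    · have hp : 0 < β ^ Nat.find hex := by positivity
      have : s * (x 0 - y 0) < 0 := by
        by_contra hc
        nlinarith [mul_nonneg hp.le (not_lt.1 hc)]
      nlinarith
    · nlinarith
  · nlinarith [mul_le_mul_of_nonneg_left hpow hs.le]

/-- Every binary sequence drives an orbit inside the interval `dom β α`, namely the values of its
tails as digit expansions in base `β`. -/
theorem exists_isOrbit_mem_dom {β : ℝ} (hβ : 1 < β) (α : ℝ) (ω : ℕ → Fin 2) :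
    ∃ x, IsOrbit β α x ω ∧ ∀ n, x n ∈ dom β α := by
  have hβ0 : 0 < β := by linarith
  have hβ1 : 0 < β - 1 := by linarith
  set r := β⁻¹ with hr
  have hr0 : 0 < r := inv_pos.2 hβ0
  have hr1 : r < 1 := inv_lt_one_of_one_lt₀ hβ
  have hgeo : HasSum (fun k : ℕ => r ^ (k + 1)) (1 / (β - 1)) := by
    have h1 : (fun k : ℕ => r ^ (k + 1)) = fun k => r * r ^ k := funext fun k => pow_succ' r k
    have h2 : 1 / (β - 1) = r * (1 - r)⁻¹ := by
      rw [hr]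
      field_simp
    rw [h1, h2]
    exact (hasSum_geometric_of_lt_one hr0.le hr1).mul_left r
  let f : ℕ → ℕ → ℝ := fun n k => ((ω (n + k) : ℕ) : ℝ) * r ^ (k + 1)
  have hd : ∀ i, ((ω i : ℕ) : ℝ) ≤ 1 := fun i => by
    exact_mod_cast Nat.lt_succ_iff.1 (ω i).2
  have hf0 : ∀ n k, 0 ≤ f n k := fun n k => by positivity
  have hfle : ∀ n k, f n k ≤ r ^ (k + 1) := fun n k =>
    mul_le_of_le_one_left (by positivity) (hd _)
  have hfs : ∀ n, Summable (f n) := fun n =>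
    Summable.of_nonneg_of_le (hf0 n) (hfle n) hgeo.summable
  have hrec : ∀ n, ∑' k, f n k = r * ((ω n : ℕ) : ℝ) + r * ∑' k, f (n + 1) k := by
    intro n
    rw [(hfs n).tsum_eq_zero_add, ← tsum_mul_left]
    congr 1
    · simp [f, mul_comm]
    · refine tsum_congr fun k => ?_
      simp only [f]
      rw [show n + (k + 1) = n + 1 + k by omega]
      ring
  refine ⟨fun n => ∑' k, f n k - α / (β - 1), fun n => ?_, fun n => ⟨?_, ?_⟩⟩
  · simp only
    rw [hrec n, hr]
    field_simp
    ring
  · have : 0 ≤ ∑' k, f n k := tsum_nonneg (hf0 n)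
    rw [neg_div]
    linarith
  · have := (hfs n).tsum_le_tsum (hfle n) hgeo.summable
    rw [hgeo.tsum_eq] at this
    rw [sub_div]
    linarith

/-! ### The intermediate beta-transformations -/

section Transformations

variable {β α : ℝ}

theorem isOrbit_tauPlus (x : ℝ) :
    IsOrbit β α (fun n => (Tplus β α)^[n] x) (tauPlus β α x) := by
  intro n
  simp only [Function.iterate_succ_apply', tauPlus]
  rw [Tplus]
  split_ifs <;> simp

theorem isOrbit_tauMinus (x : ℝ) :
    IsOrbit β α (fun n => (Tminus β α)^[n] x) (tauMinus β α x) := by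
  intro n
  simp only [Function.iterate_succ_apply', tauMinus]
  rw [Tminus]
  split_ifs <;> simp

theorem tauPlus_eq_zero_iff (x : ℝ) (n : ℕ) :
    tauPlus β α x n = 0 ↔ (Tplus β α)^[n] x < critPt β α := by
  simp [tauPlus]

theorem tauPlus_eq_one_iff (x : ℝ) (n : ℕ) :
    tauPlus β α x n = 1 ↔ critPt β α ≤ (Tplus β α)^[n] x := by
  simp [tauPlus]

theorem tauMinus_eq_zero_iff (x : ℝ) (n : ℕ) :
    tauMinus β α x n = 0 ↔ (Tminus β α)^[n] x ≤ critPt β α := by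
  simp [tauMinus]

theorem tauMinus_eq_one_iff (x : ℝ) (n : ℕ) :
    tauMinus β α x n = 1 ↔ critPt β α < (Tminus β α)^[n] x := by
  simp [tauMinus]

theorem shift_tauPlus (x : ℝ) (k : ℕ) :
    shift k (tauPlus β α x) = tauPlus β α ((Tplus β α)^[k] x) := by
  ext n
  simp only [shift_apply, tauPlus, ← Function.iterate_add_apply, add_comm k]

theorem shift_tauMinus (x : ℝ) (k : ℕ) :
    shift k (tauMinus β α x) = tauMinus β α ((Tminus β α)^[k] x) := by
  ext n
  simp only [shift_apply, tauMinus, ← Function.iterate_add_apply, add_comm k]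

theorem tauPlus_eq_of_isOrbit {x : ℕ → ℝ} {ω : ℕ → Fin 2} (hx : IsOrbit β α x ω)
    (h : ∀ n, ω n = 0 ↔ x n < critPt β α) : tauPlus β α (x 0) = ω := by
  have hT : ∀ n, (Tplus β α)^[n] (x 0) = x n := by
    intro n
    induction n with
    | zero => rfl
    | succ n ih =>
      rw [Function.iterate_succ_apply', ih, hx n, Tplus]
      by_cases h0 : ω n = 0
      · simp [(h n).1 h0, h0]
      · have h1 : ω n = 1 := by omega
        simp [mt (h n).2 h0, h1]
  funext n
  by_cases h0 : ω n = 0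
  · rw [h0, tauPlus_eq_zero_iff, hT]
    exact (h n).1 h0
  · have h1 : ω n = 1 := by omega
    rw [h1, tauPlus_eq_one_iff, hT]
    exact not_lt.1 (mt (h n).2 h0)

theorem tauMinus_eq_of_isOrbit {x : ℕ → ℝ} {ω : ℕ → Fin 2} (hx : IsOrbit β α x ω)
    (h : ∀ n, ω n = 0 ↔ x n ≤ critPt β α) : tauMinus β α (x 0) = ω := by
  have hT : ∀ n, (Tminus β α)^[n] (x 0) = x n := by
    intro n
    induction n with
    | zero => rfl
    | succ n ih =>
      rw [Function.iterate_succ_apply', ih, hx n, Tminus]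
      by_cases h0 : ω n = 0
      · simp [(h n).1 h0, h0]
      · have h1 : ω n = 1 := by omega
        simp [mt (h n).2 h0, h1]
  funext n
  by_cases h0 : ω n = 0
  · rw [h0, tauMinus_eq_zero_iff, hT]
    exact (h n).1 h0
  · have h1 : ω n = 1 := by omega
    rw [h1, tauMinus_eq_one_iff, hT]
    exact not_le.1 (mt (h n).2 h0)

theorem critPt_mem_dom (hβ : 1 < β) (h0 : 0 ≤ α) (h2 : α ≤ 2 - β) :
    critPt β α ∈ dom β α := by
  have hβ1 : 0 < β - 1 := by linarith
  have hα : 0 ≤ 1 - α := by linarith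
  constructor
  · have : 0 ≤ critPt β α := div_nonneg hα (by linarith)
    have : -α / (β - 1) ≤ 0 := div_nonpos_of_nonpos_of_nonneg (by linarith) hβ1.le
    linarith
  · exact div_le_div_of_nonneg_left hα hβ1 (by linarith)

/-- Both branches map the part of the interval on their side of the critical point into it. -/
theorem branch_mem_dom (hβ : 1 < β) (h0 : 0 ≤ α) (h2 : α ≤ 2 - β) {x : ℝ} (hx : x ∈ dom β α) :
    (x ≤ critPt β α → β * x + α ∈ dom β α) ∧ (critPt β α ≤ x → β * x + α - 1 ∈ dom β α) := by
  have hβ1 : 0 < β - 1 := by linarith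
  simp only [dom, critPt, Set.mem_Icc, div_le_iff₀ hβ1, le_div_iff₀ hβ1,
    div_le_iff₀ (show 0 < β by linarith), le_div_iff₀ (show 0 < β by linarith)] at hx ⊢
  obtain ⟨hx1, hx2⟩ := hx
  refine ⟨fun h => ⟨?_, ?_⟩, fun h => ⟨?_, ?_⟩⟩ <;> nlinarith

theorem iterate_Tplus_mem_dom (hβ : 1 < β) (h0 : 0 ≤ α) (h2 : α ≤ 2 - β) {x : ℝ}
    (hx : x ∈ dom β α) (n : ℕ) : (Tplus β α)^[n] x ∈ dom β α := by
  have hmaps : Set.MapsTo (Tplus β α) (dom β α) (dom β α) := fun y hy => by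
    rw [Tplus]
    split_ifs with h
    · exact (branch_mem_dom hβ h0 h2 hy).1 h.le
    · exact (branch_mem_dom hβ h0 h2 hy).2 (not_lt.1 h)
  exact hmaps.iterate n hx

theorem iterate_Tminus_mem_dom (hβ : 1 < β) (h0 : 0 ≤ α) (h2 : α ≤ 2 - β) {x : ℝ}
    (hx : x ∈ dom β α) (n : ℕ) : (Tminus β α)^[n] x ∈ dom β α := by
  have hmaps : Set.MapsTo (Tminus β α) (dom β α) (dom β α) := fun y hy => by
    rw [Tminus]
    split_ifs with h
    · exact (branch_mem_dom hβ h0 h2 hy).1 h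
    · exact (branch_mem_dom hβ h0 h2 hy).2 (not_le.1 h).le
  exact hmaps.iterate n hx

theorem abs_le_of_mem_dom {x : ℝ} (hx : x ∈ dom β α) :
    |x| ≤ max |-α / (β - 1)| |(1 - α) / (β - 1)| := abs_le_max_abs_abs hx.1 hx.2

/-! ### The beta-shift in terms of the kneading sequences -/

theorem betaShift_subset_lexGap (hβ : 1 < β) :
    betaShift β α ⊆ lexGap (tauMinus β α (critPt β α)) (tauPlus β α (critPt β α)) := by
  have hplus : ∀ (y : ℝ) n, tauPlus β α y n = 1 → critPt β α ≤ (Tplus β α)^[n] y :=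
    fun y n => (tauPlus_eq_one_iff y n).1
  have hplus' : ∀ (y : ℝ) n, tauPlus β α y n = 0 → (Tplus β α)^[n] y ≤ critPt β α :=
    fun y n h => ((tauPlus_eq_zero_iff y n).1 h).le
  have hminus : ∀ (y : ℝ) n, tauMinus β α y n = 0 → (Tminus β α)^[n] y ≤ critPt β α :=
    fun y n => (tauMinus_eq_zero_iff y n).1
  have hminus' : ∀ (y : ℝ) n, tauMinus β α y n = 1 → critPt β α ≤ (Tminus β α)^[n] y :=
    fun y n h => ((tauMinus_eq_one_iff y n).1 h).le
  rintro _ (⟨x, -, rfl⟩ | ⟨x, -, rfl⟩) n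
  · rw [shift_tauPlus, tauPlus_eq_zero_iff, tauPlus_eq_one_iff]
    refine ⟨fun h => ?_, fun h => ?_⟩
    · exact (isOrbit_tauPlus _).lexLE_of_lt hβ (isOrbit_tauMinus _) (hplus _) (hminus _) h
    · rcases h.eq_or_lt with h | h
      · rw [← h]
        exact LexLE.refl _
      · exact (isOrbit_tauPlus _).lexLE_of_lt hβ (isOrbit_tauPlus _) (hplus _) (hplus' _) h
  · rw [shift_tauMinus, tauMinus_eq_zero_iff, tauMinus_eq_one_iff]
    refine ⟨fun h => ?_, fun h => ?_⟩
    · rcases h.eq_or_lt with h | h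
      · rw [h]
        exact LexLE.refl _
      · exact (isOrbit_tauMinus _).lexLE_of_lt hβ (isOrbit_tauMinus _) (hminus' _) (hminus _) h
    · exact (isOrbit_tauPlus _).lexLE_of_lt hβ (isOrbit_tauMinus _) (hplus _) (hminus _) h

/-- If the letters of a sequence in `lexGap` are separated by the critical point up to an error `D`,
then they are separated up to the error `D / β`, except at the tails that are equal to a kneading
sequence, that is, to one of the two expansions of the critical point. -/
theorem separation_step (hβ : 1 < β) {x : ℕ → ℝ} {ω : ℕ → Fin 2} (hx : IsOrbit β α x ω)
    (hω : ω ∈ lexGap (tauMinus β α (critPt β α)) (tauPlus β α (critPt β α))) {D : ℝ} (hD : 0 ≤ D)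
    (h0 : ∀ n, ω n = 0 → x n - critPt β α ≤ D) (h1 : ∀ n, ω n = 1 → critPt β α - x n ≤ D) (n : ℕ) :
    (ω n = 0 → shift n ω = tauMinus β α (critPt β α) ∨ x n - critPt β α < D / β) ∧
    (ω n = 1 → shift n ω = tauPlus β α (critPt β α) ∨ critPt β α - x n < D / β) := by
  constructor
  · intro hn
    have hu0 : tauMinus β α (critPt β α) 0 = 0 := (tauMinus_eq_zero_iff _ 0).2 le_rfl
    have := (hx.shift n).eq_or_mul_sub_lt (s := 1) hβ (isOrbit_tauMinus (critPt β α))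
      (by rw [hu0]; exact hn) hD fun m hm hne => by
        have hle := (hω n).1 hn m hm
        have hw : ω (n + m) = 0 := by
          have hne' : ω (n + m) ≠ _ := hne
          have hle' : ω (n + m) ≤ _ := hle
          omega
        have hm1 : tauMinus β α (critPt β α) m = 1 := by
          have hne' : ω (n + m) ≠ _ := hne
          omega
        have := (tauMinus_eq_one_iff _ _).1 hm1
        have := h0 _ hw
        linarith
    simpa using this
  · intro hn
    have hv0 : tauPlus β α (critPt β α) 0 = 1 := (tauPlus_eq_one_iff _ 0).2 le_rfl
    have := (hx.shift n).eq_or_mul_sub_lt (s := -1) hβ (isOrbit_tauPlus (critPt β α))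
      (by rw [hv0]; exact hn) hD fun m hm hne => by
        have hle := (hω n).2 hn m fun i hi => (hm i hi).symm
        have hw : ω (n + m) = 1 := by
          have hne' : ω (n + m) ≠ _ := hne
          have hle' : _ ≤ ω (n + m) := hle
          omega
        have hm1 : tauPlus β α (critPt β α) m = 0 := by
          have hne' : ω (n + m) ≠ _ := hne
          omega
        have := (tauPlus_eq_zero_iff _ _).1 hm1
        have := h1 _ hw
        linarith
    simpa using this

theorem lexGap_subset_betaShift (hβ : 1 < β) (hα0 : 0 ≤ α) (hα2 : α ≤ 2 - β) :
    lexGap (tauMinus β α (critPt β α)) (tauPlus β α (critPt β α)) ⊆ betaShift β α := by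
  intro ω hω
  have hβ0 : 0 < β := by linarith
  obtain ⟨x, hx, hxdom⟩ := exists_isOrbit_mem_dom hβ α ω
  set p := critPt β α with hp
  have hpdom : p ∈ dom β α := critPt_mem_dom hβ hα0 hα2
  set C := max |-α / (β - 1)| |(1 - α) / (β - 1)| with hC
  have hxC : ∀ n, |x n| ≤ C := fun n => abs_le_of_mem_dom (hxdom n)
  have hC0 : 0 ≤ C := (abs_nonneg _).trans (hxC 0)
  have hpC : |p| ≤ C := abs_le_of_mem_dom hpdom
  have hequ : ∀ n, shift n ω = tauMinus β α p → x n = p := fun n h => by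
    have hs := hx.shift n
    rw [h] at hs
    exact hs.start_eq_of_bounded hβ (isOrbit_tauMinus p) (fun m => hxC _)
      fun m => abs_le_of_mem_dom (iterate_Tminus_mem_dom hβ hα0 hα2 hpdom m)
  have heqv : ∀ n, shift n ω = tauPlus β α p → x n = p := fun n h => by
    have hs := hx.shift n
    rw [h] at hs
    exact hs.start_eq_of_bounded hβ (isOrbit_tauPlus p) (fun m => hxC _)
      fun m => abs_le_of_mem_dom (iterate_Tplus_mem_dom hβ hα0 hα2 hpdom m)
  -- Iterating `separation_step` from the trivial bound makes the error arbitrarily small.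
  have hiter : ∀ k n, (ω n = 0 → x n - p ≤ 2 * C / β ^ k) ∧ (ω n = 1 → p - x n ≤ 2 * C / β ^ k) := by
    intro k
    induction k with
    | zero =>
      intro n
      have h1 := abs_le.1 (hxC n)
      have h2 := abs_le.1 hpC
      constructor <;> intro _ <;> simp only [pow_zero, div_one] <;> linarith
    | succ k ih =>
      intro n
      have hD : 0 ≤ 2 * C / β ^ k := by positivity
      have hD' : 0 ≤ 2 * C / β ^ k / β := by positivity
      have hs := separation_step hβ hx hω hD (fun n => (ih n).1) (fun n => (ih n).2) n
      rw [pow_succ, ← div_div]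
      refine ⟨fun h => ?_, fun h => ?_⟩
      · rcases hs.1 h with h | h
        · rw [hequ n h]
          simpa using hD'
        · exact h.le
      · rcases hs.2 h with h | h
        · rw [heqv n h]
          simpa using hD'
        · exact h.le
  have hlim : Filter.Tendsto (fun k : ℕ => 2 * C / β ^ k) Filter.atTop (nhds 0) :=
    Filter.Tendsto.div_atTop tendsto_const_nhds (tendsto_pow_atTop_atTop_of_one_lt hβ)
  have hle0 : ∀ n, ω n = 0 → x n - p ≤ 0 := fun n h =>
    ge_of_tendsto' hlim fun k => (hiter k n).1 h
  have hle1 : ∀ n, ω n = 1 → p - x n ≤ 0 := fun n h =>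
    ge_of_tendsto' hlim fun k => (hiter k n).2 h
  have hsep := separation_step hβ hx hω le_rfl hle0 hle1
  simp only [zero_div] at hsep
  by_cases hP : ∀ n, ω n = 0 → x n ≠ p
  · left
    refine ⟨x 0, hxdom 0, tauPlus_eq_of_isOrbit hx fun n => ⟨fun h => ?_, fun h => ?_⟩⟩
    · exact lt_of_le_of_ne (by linarith [hle0 n h]) (hP n h)
    · by_contra hne
      linarith [hle1 n (by omega)]
  by_cases hM : ∀ n, ω n = 1 → x n ≠ p
  · right
    refine ⟨x 0, hxdom 0, tauMinus_eq_of_isOrbit hx fun n => ⟨fun h => ?_, fun h => ?_⟩⟩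
    · linarith [hle0 n h]
    · by_contra hne
      have h1 : ω n = 1 := by omega
      exact hM n h1 (le_antisymm h (by linarith [hle1 n h1]))
  -- Otherwise both kneading sequences occur as tails of `ω`. The one that starts later is a tail of
  -- the other, hence an expansion of `p` of the other kind, so it has the wrong initial letter.
  exfalso
  push Not at hP hM
  obtain ⟨n, hn0, hnp⟩ := hP
  obtain ⟨m, hm1, hmp⟩ := hM
  have hu : shift n ω = tauMinus β α p := ((hsep n).1 hn0).resolve_right (by simp [hnp, hp])
  have hv : shift m ω = tauPlus β α p := ((hsep m).2 hm1).resolve_right (by simp [hmp, hp])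
  have hbu : ∀ k, (Tminus β α)^[k] p = x (n + k) := fun k => by
    have hs := (hx.shift n).shift k
    rw [hu] at hs
    exact ((isOrbit_tauMinus p).shift k |>.start_eq_of_bounded hβ hs
      (fun j => abs_le_of_mem_dom (iterate_Tminus_mem_dom hβ hα0 hα2 hpdom _)) fun j => hxC _)
  have hbv : ∀ k, (Tplus β α)^[k] p = x (m + k) := fun k => by
    have hs := (hx.shift m).shift k
    rw [hv] at hs
    exact ((isOrbit_tauPlus p).shift k |>.start_eq_of_bounded hβ hs
      (fun j => abs_le_of_mem_dom (iterate_Tplus_mem_dom hβ hα0 hα2 hpdom _)) fun j => hxC _)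
  rcases le_total n m with hnm | hnm
  · obtain ⟨k, rfl⟩ := Nat.exists_eq_add_of_le hnm
    have h0 : tauMinus β α p k = 0 :=
      (tauMinus_eq_zero_iff _ _).2 (by rw [hbu, hmp])
    rw [← hu] at h0
    simp only [shift_apply] at h0
    omega
  · obtain ⟨k, rfl⟩ := Nat.exists_eq_add_of_le hnm
    have h1 : tauPlus β α p k = 1 :=
      (tauPlus_eq_one_iff _ _).2 (by rw [hbv, hnp])
    rw [← hv] at h1
    simp only [shift_apply] at h1
    omega

/-- The beta-shift is cut out by lexicographic comparison with the two expansions of the critical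
point. -/
theorem betaShift_eq_lexGap (hβ : 1 < β) (hα0 : 0 ≤ α) (hα2 : α ≤ 2 - β) :
    betaShift β α = lexGap (tauMinus β α (critPt β α)) (tauPlus β α (critPt β α)) :=
  (betaShift_subset_lexGap hβ).antisymm (lexGap_subset_betaShift hβ hα0 hα2)

end Transformations

/-! ### Finiteness of orbits in Pisot bases -/

theorem exists_norm_le_of_contracting {ρ : ℂ} (hρ : ‖ρ‖ < 1) {M : ℝ} {y : ℕ → ℂ}
    (h : ∀ n, ‖y (n + 1) - ρ * y n‖ ≤ M) : ∃ B, ∀ n, ‖y n‖ ≤ B := by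
  have h1 : 0 < 1 - ‖ρ‖ := by linarith
  have hM : 0 ≤ M := (norm_nonneg _).trans (h 0)
  refine ⟨‖y 0‖ + M / (1 - ‖ρ‖), fun n => ?_⟩
  induction n with
  | zero =>
    have : 0 ≤ M / (1 - ‖ρ‖) := by positivity
    linarith
  | succ n ih =>
    have h2 : ‖y (n + 1)‖ ≤ M + ‖ρ‖ * ‖y n‖ := by
      calc ‖y (n + 1)‖ = ‖(y (n + 1) - ρ * y n) + ρ * y n‖ := by ring_nf
        _ ≤ ‖y (n + 1) - ρ * y n‖ + ‖ρ * y n‖ := norm_add_le _ _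
        _ ≤ M + ‖ρ‖ * ‖y n‖ := by rw [norm_mul]; linarith [h n]
    have h3 : ‖ρ‖ * ‖y n‖ ≤ ‖ρ‖ * (‖y 0‖ + M / (1 - ‖ρ‖)) :=
      mul_le_mul_of_nonneg_left ih (norm_nonneg _)
    have h4 : M + ‖ρ‖ * (M / (1 - ‖ρ‖)) = M / (1 - ‖ρ‖) := by field_simp; ring
    nlinarith [norm_nonneg (y 0)]

/-- A bounded orbit with rational data in a Pisot base is finite. After clearing denominators the
orbit consists of algebraic integers of `ℚ(β)`. These have bounded conjugates: under the embedding
`β ↦ β` because the orbit is bounded, under any other because the recursion is contracting there. -/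
theorem IsOrbit.finite_range_of_isPisot {β α C : ℝ} (hβ : IsPisot β) {x : ℕ → ℝ} {ω : ℕ → Fin 2}
    (hx : IsOrbit β α x ω) (hxC : ∀ n, |x n| ≤ C) {N : ℕ} (hN : N ≠ 0) {a b : ℤ}
    (ha : N * α = a) (hb : N * x 0 = b) : (Set.range x).Finite := by
  obtain ⟨hint, -, hconj⟩ := hβ
  have hintQ : IsIntegral ℚ β := hint.tower_top
  let K := IntermediateField.adjoin ℚ {β}
  have : FiniteDimensional ℚ K := IntermediateField.adjoin.finiteDimensional hintQ
  have : NumberField K := ⟨⟩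
  let γ : K := IntermediateField.AdjoinSimple.gen ℚ β
  have hγ : algebraMap K ℝ γ = β := IntermediateField.AdjoinSimple.algebraMap_gen ℚ β
  have hγint : IsIntegral ℤ γ := by
    rw [← isIntegral_algebraMap_iff (algebraMap K ℝ).injective, hγ]
    exact hint
  let y : ℕ → K := fun n => Nat.rec (b : K) (fun n t => γ * t + a - N * ((ω n : ℕ) : K)) n
  have hy1 : ∀ n, y (n + 1) = γ * y n + a - N * ((ω n : ℕ) : K) := fun n => rfl
  have hyint : ∀ n, IsIntegral ℤ (y n) := by
    intro n
    induction n with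
    | zero => exact isIntegral_algebraMap (R := ℤ) (x := b)
    | succ n ih =>
      rw [hy1]
      refine ((hγint.mul ih).add (isIntegral_algebraMap (R := ℤ) (x := a))).sub ?_
      exact_mod_cast isIntegral_algebraMap (R := ℤ) (A := K) (x := N * (ω n : ℕ))
  have hyval : ∀ {L : Type} [Field L] [Algebra ℝ L] (φ : K →+* L), φ γ = algebraMap ℝ L β →
      ∀ n, φ (y n) = algebraMap ℝ L (N * x n) := by
    intro L _ _ φ hφ n
    induction n with
    | zero => rw [hb]; simp [y]
    | succ n ih =>
      rw [hy1, map_sub, map_add, map_mul, ih, hφ, hx n,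
        show (N : ℝ) * (β * x n + α - ((ω n : ℕ) : ℝ)) =
          β * (N * x n) + a - N * ((ω n : ℕ) : ℝ) by rw [← ha]; ring]
      simp
  have hbound : ∀ φ : K →+* ℂ, ∃ B, ∀ n, ‖φ (y n)‖ ≤ B := by
    intro φ
    by_cases hφ : φ γ = (β : ℂ)
    · refine ⟨N * C, fun n => ?_⟩
      rw [hyval φ hφ n, norm_algebraMap', Real.norm_eq_abs, abs_mul, Nat.abs_cast]
      exact mul_le_mul_of_nonneg_left (hxC n) (Nat.cast_nonneg _)
    · have hroot : Polynomial.aeval (φ γ) (minpoly ℚ β) = 0 := by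
        have h1 := Polynomial.aeval_algHom_apply φ.toRatAlgHom γ (minpoly ℚ β)
        have h2 : Polynomial.aeval γ (minpoly ℚ β) = 0 := by
          rw [← IntermediateField.minpoly_gen ℚ β]
          exact minpoly.aeval ℚ γ
        rw [h2, map_zero] at h1
        exact h1
      refine exists_norm_le_of_contracting (hconj _ hroot hφ) (y := fun n => φ (y n))
        (M := ‖(a : ℂ)‖ + N) fun n => ?_
      have h1 : φ (y (n + 1)) - φ γ * φ (y n) = a - N * ((ω n : ℕ) : ℂ) := by
        rw [hy1]; simp; ring
      have h2 : ((ω n : ℕ) : ℝ) ≤ 1 := by exact_mod_cast Nat.lt_succ_iff.1 (ω n).2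
      simp only [h1]
      refine (norm_sub_le _ _).trans (add_le_add_right ?_ _)
      rw [norm_mul, Complex.norm_natCast, Complex.norm_natCast]
      exact mul_le_of_le_one_right (Nat.cast_nonneg _) h2
  choose B hB using hbound
  obtain ⟨B', hB'⟩ := (Set.finite_range B).bddAbove
  have hfin : (Set.range y).Finite :=
    (NumberField.Embeddings.finite_of_norm_le K ℂ B').subset <| by
      rintro _ ⟨n, rfl⟩
      exact ⟨hyint n, fun φ => (hB φ n).trans (hB' ⟨φ, rfl⟩)⟩
  refine (hfin.image fun t => algebraMap K ℝ t / N).subset ?_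
  rintro _ ⟨n, rfl⟩
  refine ⟨y n, ⟨n, rfl⟩, ?_⟩
  have hN' : (N : ℝ) ≠ 0 := Nat.cast_ne_zero.2 hN
  simp only [hyval (algebraMap K ℝ) hγ n, Algebra.algebraMap_self, RingHom.id_apply]
  field_simp

theorem finite_range_of_shift {x : ℕ → ℝ} (h : (Set.range fun n => x (1 + n)).Finite) :
    (Set.range x).Finite := by
  refine (h.insert (x 0)).subset ?_
  rintro _ ⟨n, rfl⟩
  cases n with
  | zero => exact Set.mem_insert _ _
  | succ n => exact Set.mem_insert_of_mem _ ⟨n, by simp [add_comm]⟩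

theorem isSofic_betaShift_of_rat {β : ℝ} (hβ : IsPisot β) {a : ℚ} (h0 : (0 : ℝ) ≤ a)
    (h2 : (a : ℝ) ≤ 2 - β) : IsSofic (betaShift β a) := by
  have hβ1 : 1 < β := hβ.2.1
  have hpdom := critPt_mem_dom hβ1 h0 h2
  have hp : β * critPt β a + a = 1 := by
    have : β ≠ 0 := by linarith
    rw [critPt]; field_simp; ring
  have hN : (a.den : ℝ) * a = a.num := by
    exact_mod_cast Rat.den_mul_eq_num a
  rw [betaShift_eq_lexGap hβ1 h0 h2]
  -- The critical point need not be a quotient of an algebraic integer by the denominator of `a`,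
  -- but its images `1` and `0` are.
  apply isSofic_lexGap
  · have hfin : (Set.range fun n => (Tminus β a)^[n] (critPt β a)).Finite :=
      finite_range_of_shift <| ((isOrbit_tauMinus (critPt β a)).shift 1).finite_range_of_isPisot
        (b := a.den) hβ (fun n => abs_le_of_mem_dom (iterate_Tminus_mem_dom hβ1 h0 h2 hpdom _))
        a.den_nz hN (by simp [Tminus, hp])
    refine (hfin.image (tauMinus β a)).subset ?_
    rintro _ ⟨k, rfl⟩
    exact ⟨_, ⟨k, rfl⟩, (shift_tauMinus _ k).symm⟩
  · have hfin : (Set.range fun n => (Tplus β a)^[n] (critPt β a)).Finite :=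
      finite_range_of_shift <| ((isOrbit_tauPlus (critPt β a)).shift 1).finite_range_of_isPisot
        (b := 0) hβ (fun n => abs_le_of_mem_dom (iterate_Tplus_mem_dom hβ1 h0 h2 hpdom _))
        a.den_nz hN (by simp [Tplus, hp])
    refine (hfin.image (tauPlus β a)).subset ?_
    rintro _ ⟨k, rfl⟩
    exact ⟨_, ⟨k, rfl⟩, (shift_tauPlus _ k).symm⟩

end IntermediateBeta

theorem corollary1p3 (β : ℝ) (hβ : β ∈ Set.Ioo (1 : ℝ) 2) (hPisot : IntermediateBeta.IsPisot β) :
    Dense {q : IntermediateBeta.fibre β |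
      IntermediateBeta.IsSofic (IntermediateBeta.betaShift q.1.1 q.1.2)} := by
  rw [Metric.dense_iff]
  rintro ⟨⟨β', α⟩, hq, hα0, hα2⟩ r hr
  obtain rfl : β' = β := hq
  simp only at hα0 hα2
  obtain ⟨a, ha1, ha2⟩ := exists_rat_btwn (show max 0 (α - r) < min (2 - β') (α + r) from
    max_lt (lt_min (by linarith [hβ.2]) (by linarith)) (lt_min (by linarith) (by linarith)))
  obtain ⟨ha0, har⟩ := max_lt_iff.1 ha1
  obtain ⟨ha2, har'⟩ := lt_min_iff.1 ha2
  refine ⟨⟨(β', a), rfl, ha0.le, ha2.le⟩, ?_,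
    IntermediateBeta.isSofic_betaShift_of_rat hPisot ha0.le ha2.le⟩
  rw [Metric.mem_ball, Subtype.dist_eq, Prod.dist_eq]
  simp only [dist_self, Real.dist_eq]
  exact max_lt hr (abs_lt.2 ⟨by linarith, by linarith⟩)
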